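/- Let $(\Omega,\mathcal F,\mathbb P)$ be a probability space and $\mathcal H$ a real Hilbert space, not necessarily separable. Let $L^2(\Omega,\mathcal H)$ be the space of Bochner (strongly) measurable $v:\Omega\to\mathcal H$ with $\|v\|_{L^2(\Omega,\mathcal H)}^2=\int_\Omega\|v\|_{\mathcal H}^2\,d\mathbb P<\infty$, modulo almost everywhere equality, write $L^2(\Omega)=L^2(\Omega,\mathbb R)$, and write $\mathbb E(v)=\int_\Omega v\,d\mathbb P$ for the Bochner integral. A \emph{KL system} consists of a number $R\in\{0,1,2,\dots\}\cup\{\aleph_0\}$ and of families $(\lambda_r,Y_r,\phi_r)$, indexed by the positive integers $r\le R$ (by all positive integers if $R=\aleph_0$), such that 1. $\lambda_r\in(0,\infty)$ and $\lambda_1\ge\lambda_2\ge\cdots$; 2. the $Y_r$ are orthonormal in $L^2(\Omega)$ and $\mathbb E(Y_r)=0$ for all $r$; 3. the $\phi_r$ are orthonormal in $\mathcal H$. A Bochner integrable function $v:\Omega\to\mathcal H$ \emph{has the Karhunen–Loève expansion} (KLE) $$v=\mathbb E(v)+\sum_{r=1}^{R}\lambda_r^{1/2}\,Y_r\,\phi_r$$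 if $(R,(\lambda_r,Y_r,\phi_r)_r)$ is a KL system, if the identity holds almost everywhere when $R$ is finite and, when $R=\aleph_0$, the partial sums $\mathbb E(v)+\sum_{r=1}^n\lambda_r^{1/2}Y_r\phi_r$ converge to $v$ in the $L^2(\Omega,\mathcal H)$ norm, and if $\sum_{r=1}^R\lambda_r=\|v-\mathbb E(v)\|^2_{L^2(\Omega,\mathcal H)}$. **Theorem.** (a) Every $v\in L^2(\Omega,\mathcal H)$ has a KLE. (b) Conversely, every Bochner integrable $v:\Omega\to\mathcal H$ that has a KLE belongs to $L^2(\Omega,\mathcal H)$. (c) Moreover, for every KL system with $\sum_{r=1}^R\lambda_r<\infty$ and every $m\in\mathcal H$ there is a $v\in L^2(\Omega,\mathcal H)$ with $\mathbb E(v)=m$ whose KLE is $v=m+\sum_{r=1}^R\lambda_r^{1/2}Y_r\phi_r$. -/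

import Mathlib

open MeasureTheory Filter Topology

noncomputable section

/-- The index set `{r ∈ ℕ : r < R}` of an expansion with `R ∈ ℕ ∪ {ℵ₀}` terms
(`R = ⊤` is the countably infinite case; indices start at `0`). -/
abbrev KLEIndex (R : ℕ∞) : Type := {r : ℕ // (r : ℕ∞) < R}

open Classical in
/-- The sum of the first `n` terms `√(λ_r) Y_r(ω) φ_r` of the expansion (the sum of all its
terms, if there are at most `n` of them). -/
def klePartialSum {Ω : Type*} [MeasurableSpace Ω] {μ : Measure Ω}
    {H : Type*} [NormedAddCommGroup H] [InnerProductSpace ℝ H]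
    {R : ℕ∞} (lam : KLEIndex R → ℝ) (Y : KLEIndex R → Lp ℝ 2 μ) (φ : KLEIndex R → H)
    (n : ℕ) (ω : Ω) : H :=
  ∑ r ∈ Finset.range n,
    if h : (r : ℕ∞) < R then (Real.sqrt (lam ⟨r, h⟩) * Y ⟨r, h⟩ ω) • φ ⟨r, h⟩ else 0

/-- The conditions on the triples `(λ_r, Y_r, φ_r)` that do not involve the expanded function. -/
structure IsKLESystem {Ω : Type*} [MeasurableSpace Ω] (μ : Measure Ω)
    {H : Type*} [NormedAddCommGroup H] [InnerProductSpace ℝ H]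
    (R : ℕ∞) (lam : KLEIndex R → ℝ) (Y : KLEIndex R → Lp ℝ 2 μ) (φ : KLEIndex R → H) :
    Prop where
  lam_pos : ∀ r, 0 < lam r
  lam_antitone : Antitone lam
  Y_orthonormal : Orthonormal ℝ Y
  Y_mean_zero : ∀ r, ∫ ω, Y r ω ∂μ = 0
  φ_orthonormal : Orthonormal ℝ φ

/-- `v = E(v) + ∑_{r < R} √(λ_r) Y_r φ_r` is a Karhunen–Loève expansion of the Bochner integrable
function `v`. Square integrability of `v` is not presupposed: the two `L²` norms below
take values in `[0, ∞]`. If `R` is finite then the partial sums are eventually constant, and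
`tendsto_sum` is equality almost everywhere. -/
structure IsKLE {Ω : Type*} [MeasurableSpace Ω] (μ : Measure Ω)
    {H : Type*} [NormedAddCommGroup H] [InnerProductSpace ℝ H]
    (v : Ω → H)
    (R : ℕ∞) (lam : KLEIndex R → ℝ) (Y : KLEIndex R → Lp ℝ 2 μ) (φ : KLEIndex R → H) :
    Prop extends IsKLESystem μ R lam Y φ where
  integrable : Integrable v μ
  tendsto_sum : Tendsto
    (fun n : ℕ => eLpNorm (fun ω => v ω - (∫ x, v x ∂μ) - klePartialSum lam Y φ n ω) 2 μ)
    atTop (𝓝 0)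
  sum_lam : ∑' r, ENNReal.ofReal (lam r) = eLpNorm (fun ω => v ω - ∫ x, v x ∂μ) 2 μ ^ 2

/-- `v` admits a Karhunen–Loève expansion. -/
def AdmitsKLE {Ω : Type*} [MeasurableSpace Ω] (μ : Measure Ω)
    {H : Type*} [NormedAddCommGroup H] [InnerProductSpace ℝ H] (v : Ω → H) : Prop :=
  ∃ (R : ℕ∞) (lam : KLEIndex R → ℝ) (Y : KLEIndex R → Lp ℝ 2 μ) (φ : KLEIndex R → H),
    IsKLE μ v R lam Y φ

end

open InnerProductSpace

/-! ### Enumeration of a summable positive family in decreasing order. -/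

section Rearrangement

/-! For (a), let `u` be `v` minus its mean and `A` the operator `x ↦ ⟪x, u⟫` from `H` to `L²(Ω)`. It
is compact (`isCompactOperator_coordLp`), so `A* A` has an orthonormal eigenbasis. The eigenvectors
with eigenvalue `λ > 0` are the `φ`, and their images under `A`, divided by `√λ`, are the `Y`; these
have mean zero because `u` does. Bessel's inequality for `u` makes the eigenvalues summable, so the
series converges. Its sum has the same coordinates as `u` on a dense subspace, hence equals `u` by
`eq_zero_of_coordLp_eq_zero`, where strong measurability stands in for separability of `H`.
Summability also makes the positive eigenvalues countable and lets them be listed in decreasing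
order.

For (b), partial sums are square integrable and some remainder has finite norm. For (c), an
orthogonal series with summable squared norms converges; `IsKLESystem.isKLE_of_hasSum` then yields
the expansion, as it does in (a). -/

theorem IsLowerSet.exists_enat_forall_mem_iff {S : Set ℕ} (hS : IsLowerSet S) :
    ∃ R : ℕ∞, ∀ n : ℕ, n ∈ S ↔ (n : ℕ∞) < R := by
  classical
  by_cases h : ∃ n, n ∉ S
  · refine ⟨(Nat.find h : ℕ), fun n => ?_⟩
    rw [Nat.cast_lt]
    constructor
    · intro hn
      by_contra! hle
      exact Nat.find_spec h (hS hle hn)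
    · intro hn
      by_contra hc
      exact Nat.find_min h hn hc
  · push Not at h
    exact ⟨⊤, fun n => by simp [h n]⟩

/-- A relation which is a strict linear order with finite initial segments has a rank function
that is an isomorphism onto an initial segment of `ℕ`. -/
theorem exists_enat_equiv_of_finite_initial_segments {ι : Type*} (r : ι → ι → Prop)
    [IsStrictTotalOrder ι r] (hfin : ∀ i, {j | r j i}.Finite) :
    ∃ (R : ℕ∞) (e : KLEIndex R ≃ ι), ∀ a b, r (e a) (e b) ↔ a < b := by
  set rank : ι → ℕ := fun i => {j | r j i}.ncard with hrank
  have hmono : ∀ i j, r i j → rank i < rank j := by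
    intro i j hij
    refine Set.ncard_lt_ncard ?_ (hfin j)
    refine ⟨fun k hk => _root_.trans (r := r) hk hij, fun h => ?_⟩
    exact irrefl (r := r) i (h hij)
  have hiff : ∀ i j, r i j ↔ rank i < rank j := by
    refine fun i j => ⟨hmono i j, fun h => ?_⟩
    rcases trichotomous_of r i j with h' | h' | h'
    · exact h'
    · subst h'; exact absurd h (lt_irrefl _)
    · exact absurd (hmono j i h') h.asymm
  have hinj : Function.Injective rank := by
    intro i j h
    rcases trichotomous_of r i j with h' | h' | h'
    · exact absurd (hmono i j h') h.not_lt
    · exact h'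
    · exact absurd (hmono j i h') h.not_gt
  have hpred : ∀ i n, rank i = n + 1 → ∃ j, rank j = n := by
    intro i n hi
    have hne : {j | r j i}.Nonempty := by
      rw [← Set.ncard_pos (hfin i)]
      exact Nat.lt_of_lt_of_eq (Nat.succ_pos n) hi.symm
    -- A predecessor of `i` of maximal rank is its immediate predecessor, so the rank drops by
    -- exactly one and no value is skipped.
    obtain ⟨m, hm, hmax⟩ := (hfin i).exists_maximalFor rank _ hne
    refine ⟨m, ?_⟩
    have hins : {j | r j i} = insert m {j | r j m} := by
      ext k
      simp only [Set.mem_ofPred_eq, Set.mem_insert_iff]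
      constructor
      · intro hk
        rcases trichotomous_of r k m with h' | h' | h'
        · exact .inr h'
        · exact .inl h'
        · exact absurd (hmax hk (hmono _ _ h').le) (hmono _ _ h').not_ge
      · rintro (rfl | hk)
        · exact hm
        · exact _root_.trans (r := r) hk hm
    have : rank i = rank m + 1 := by
      simp only [hrank]
      have hm' : m ∉ {j | r j m} := fun h => irrefl (r := r) m h
      rw [hins, Set.ncard_insert_of_notMem hm' (hfin m)]
    omega
  have hlow : IsLowerSet (Set.range rank) := by
    suffices H : ∀ d n, n + d ∈ Set.range rank → n ∈ Set.range rank by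
      intro a b hba ha
      exact H (a - b) b (by rwa [Nat.add_sub_cancel' hba])
    intro d
    induction d with
    | zero => exact fun n h => h
    | succ d ih =>
      rintro n ⟨i, hi⟩
      exact ih n (hpred i (n + d) hi)
  obtain ⟨R, hR⟩ := hlow.exists_enat_forall_mem_iff
  let f : ι → KLEIndex R := fun i => ⟨rank i, (hR _).1 ⟨i, rfl⟩⟩
  have hf : Function.Bijective f := by
    refine ⟨fun i j h => hinj (congrArg Subtype.val h), fun a => ?_⟩
    obtain ⟨i, hi⟩ := (hR a.1).2 a.2
    exact ⟨i, Subtype.ext hi⟩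
  refine ⟨R, (Equiv.ofBijective f hf).symm, fun a b => ?_⟩
  rw [hiff]
  change f _ < f _ ↔ _
  rw [Equiv.ofBijective_apply_symm_apply f hf, Equiv.ofBijective_apply_symm_apply f hf]

/-- A summable family of positive numbers can be listed in decreasing order. -/
theorem exists_enat_equiv_antitone_of_summable {ι : Type*} {lam : ι → ℝ} (hpos : ∀ i, 0 < lam i)
    (hsum : Summable lam) : ∃ (R : ℕ∞) (e : KLEIndex R ≃ ι), Antitone (lam ∘ e) := by
  have hcount : Countable ι := by
    have h := hsum.countable_support
    rw [Function.support_eq_univ fun i => (hpos i).ne'] at h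
    exact Set.countable_univ_iff.1 h
  obtain ⟨f, hf⟩ := exists_injective_nat ι
  -- Equal values are ordered by an injection into `ℕ`, which makes the order total.
  let r : ι → ι → Prop := fun j i => lam i < lam j ∨ (lam i = lam j ∧ f j < f i)
  have : IsStrictTotalOrder ι r :=
    { irrefl := fun i h => by rcases h with h | h <;> simp at h
      trans := by
        rintro a b c (h | ⟨h, h'⟩) (k | ⟨k, k'⟩)
        · exact .inl (k.trans h)
        · exact .inl (k ▸ h)
        · exact .inl (h ▸ k)
        · exact .inr ⟨k.trans h, h'.trans k'⟩
      trichotomous := by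
        intro a b hab hba
        simp only [r, not_or, not_and, not_lt] at hab hba
        have h := le_antisymm hba.1 hab.1
        exact hf (le_antisymm (hba.2 h.symm) (hab.2 h)) }
  have hfin : ∀ i, {j | r j i}.Finite := by
    intro i
    -- Only finitely many terms are at least `lam i`, since the terms tend to zero.
    have h := hsum.tendsto_cofinite_zero.eventually_lt_const (hpos i)
    refine Set.Finite.subset (Filter.eventually_cofinite.1 h) ?_
    rintro j (hj | hj)
    · exact hj.not_gt
    · exact hj.1.not_gt
  obtain ⟨R, e, he⟩ := exists_enat_equiv_of_finite_initial_segments r hfin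
  refine ⟨R, e, fun a b hab => ?_⟩
  rcases hab.eq_or_lt with rfl | hlt
  · exact le_rfl
  · rcases (he a b).2 hlt with h | h
    · exact h.le
    · exact h.1.le

end Rearrangement

/-! ### Coordinates and elementary tensors in `L²(Ω, H)`. -/

section TensorLp

variable {Ω : Type*} [MeasurableSpace Ω] {μ : Measure Ω}
  {H : Type*} [NormedAddCommGroup H] [InnerProductSpace ℝ H]

/-- The bilinear map sending `u ∈ L²(Ω, H)` and `x ∈ H` to `⟪x, u⟫ ∈ L²(Ω)`. -/
noncomputable def coordLp (μ : Measure Ω) (H : Type*) [NormedAddCommGroup H] [InnerProductSpace ℝ H] :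
    Lp H 2 μ →L[ℝ] H →L[ℝ] Lp ℝ 2 μ :=
  LinearMap.mkContinuous₂
    (LinearMap.mk₂ ℝ (fun u x => (innerSL ℝ x).compLp u)
      (fun u v x => map_add ((innerSL ℝ x).compLpₗ 2 μ) u v)
      (fun c u x => map_smul ((innerSL ℝ x).compLpₗ 2 μ) c u)
      (fun u x y => by rw [map_add, ContinuousLinearMap.add_compLp])
      (fun c u x => by rw [map_smul, ContinuousLinearMap.smul_compLp])) 1
    (fun u x => by
      rw [one_mul, mul_comm]
      exact (ContinuousLinearMap.norm_compLp_le _ _).trans_eq (by rw [innerSL_apply_norm]))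

theorem coeFn_coordLp (u : Lp H 2 μ) (x : H) :
    coordLp μ H u x =ᵐ[μ] fun ω => inner ℝ x (u ω) :=
  (innerSL ℝ x).coeFn_compLp' u

/-- The function `ω ↦ f ω • φ` in `L²(Ω, H)`. -/
noncomputable def tensorLp (f : Lp ℝ 2 μ) (φ : H) : Lp H 2 μ :=
  (ContinuousLinearMap.toSpanSingleton ℝ φ).compLp f

theorem coeFn_tensorLp (f : Lp ℝ 2 μ) (φ : H) : tensorLp f φ =ᵐ[μ] fun ω => f ω • φ :=
  (ContinuousLinearMap.toSpanSingleton ℝ φ).coeFn_compLp' f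

/-- Taking the coordinate along `φ` is adjoint to tensoring with `φ`. -/
theorem inner_tensorLp_left (f : Lp ℝ 2 μ) (φ : H) (u : Lp H 2 μ) :
    inner ℝ (tensorLp f φ) u = inner ℝ f (coordLp μ H u φ) := by
  rw [L2.inner_def, L2.inner_def]
  refine integral_congr_ae ?_
  filter_upwards [coeFn_tensorLp f φ, coeFn_coordLp u φ] with ω h1 h2
  rw [h1, h2, real_inner_smul_left, real_inner_comm]
  simp [mul_comm]

theorem coordLp_tensorLp (f : Lp ℝ 2 μ) (φ x : H) :
    coordLp μ H (tensorLp f φ) x = inner ℝ x φ • f := by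
  refine Lp.ext ?_
  filter_upwards [coeFn_tensorLp f φ, coeFn_coordLp (tensorLp f φ) x,
    Lp.coeFn_smul (inner ℝ x φ) f] with ω h1 h2 h3
  rw [h2, h1, h3, inner_smul_right]
  simp [mul_comm]

theorem inner_tensorLp_tensorLp (f g : Lp ℝ 2 μ) (φ ψ : H) :
    inner ℝ (tensorLp f φ) (tensorLp g ψ) = inner ℝ φ ψ * inner ℝ f g := by
  rw [inner_tensorLp_left, coordLp_tensorLp, inner_smul_right]

theorem Orthonormal.tensorLp {ι : Type*} {Y : ι → Lp ℝ 2 μ} {φ : ι → H} (hY : Orthonormal ℝ Y)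
    (hφ : Orthonormal ℝ φ) : Orthonormal ℝ fun i => _root_.tensorLp (Y i) (φ i) := by
  classical
  rw [orthonormal_iff_ite] at *
  intro i j
  rw [inner_tensorLp_tensorLp, hY, hφ]
  split_ifs <;> simp

/-- An element of `L²(Ω, H)` all of whose coordinates vanish is zero, also if `H` is not
separable. -/
theorem eq_zero_of_coordLp_eq_zero [CompleteSpace H] {u : Lp H 2 μ} (hu : coordLp μ H u = 0) :
    u = 0 := by
  rw [Lp.eq_zero_iff_ae_eq_zero]
  -- The exceptional null set depends on the functional; an essentially separable range reduces the
  -- test to countably many functionals.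
  obtain ⟨t, ht, hut⟩ := (Lp.aestronglyMeasurable u).isSeparable_ae_range
  refine ae_eq_zero_of_forall_dual_of_isSeparable ℝ ht (fun c => ?_) hut
  have h := coeFn_coordLp u ((toDual ℝ H).symm c)
  rw [hu] at h
  filter_upwards [h, Lp.coeFn_zero ℝ 2 μ] with ω h1 h2
  rw [toDual_symm_apply] at h1
  rw [← h1, zero_apply, h2]

/-- An indicator times a constant vector gives a rank-one operator. Sums and norm limits of compact
operators are compact, and simple functions are dense. -/
theorem isCompactOperator_coordLp (u : Lp H 2 μ) : IsCompactOperator (coordLp μ H u) := by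
  refine Lp.induction (by norm_num) (motive := fun u => IsCompactOperator (coordLp μ H u))
    ?_ ?_ ?_ u
  · intro c s hs hμs
    have h : coordLp μ H (Lp.simpleFunc.indicatorConst 2 hs hμs.ne c : Lp H 2 μ) =
        (rankOne ℝ (indicatorConstLp 2 hs hμs.ne (1 : ℝ)) c : H →L[ℝ] Lp ℝ 2 μ) := by
      ext1 x
      rw [rankOne_apply]
      refine Lp.ext ?_
      rw [Lp.simpleFunc.coe_indicatorConst]
      filter_upwards [coeFn_coordLp (indicatorConstLp 2 hs hμs.ne c) x,
        indicatorConstLp_coeFn (p := 2) (hs := hs) (hμs := hμs.ne) (c := c),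
        indicatorConstLp_coeFn (p := 2) (hs := hs) (hμs := hμs.ne) (c := (1 : ℝ)),
        Lp.coeFn_smul (inner ℝ c x) (indicatorConstLp 2 hs hμs.ne (1 : ℝ))] with ω h1 h2 h3 h4
      rw [h1, h2, h4, Pi.smul_apply, h3]
      by_cases hω : ω ∈ s <;> simp [hω, real_inner_comm]
    rw [h, rankOne_def']
    exact (isCompactOperator_of_locallyCompactSpace_rng (ContinuousLinearMap.toSpanSingleton ℝ
      (indicatorConstLp 2 hs hμs.ne (1 : ℝ)))).comp_clm (innerSL ℝ c)
  · intro f g hf hg _ h1 h2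
    rw [map_add]
    exact h1.add h2
  · exact isClosed_setOfPred_isCompactOperator.preimage (coordLp μ H).continuous

theorem integral_coordLp [IsProbabilityMeasure μ] [CompleteSpace H] (u : Lp H 2 μ) (x : H) :
    ∫ ω, coordLp μ H u x ω ∂μ = inner ℝ x (∫ ω, u ω ∂μ) := by
  rw [integral_congr_ae (coeFn_coordLp u x)]
  exact integral_inner ((Lp.memLp u).integrable one_le_two) x

end TensorLp

/-! ### From a convergent orthogonal series to an expansion, and square integrability. -/

section System

variable {Ω : Type*} [MeasurableSpace Ω] {μ : Measure Ω}
  {H : Type*} [NormedAddCommGroup H] [InnerProductSpace ℝ H]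

theorem summable_sqrt_smul_tensorLp [CompleteSpace H] {ι : Type*} {lam : ι → ℝ}
    {Y : ι → Lp ℝ 2 μ} {φ : ι → H}
    (hlam : ∀ i, 0 ≤ lam i) (hY : Orthonormal ℝ Y) (hφ : Orthonormal ℝ φ) (hs : Summable lam) :
    Summable fun i => Real.sqrt (lam i) • tensorLp (Y i) (φ i) := by
  have h := ((hY.tensorLp hφ).orthogonalFamily.summable_iff_norm_sq_summable
    fun i => Real.sqrt (lam i)).2 (by simpa [Real.sq_sqrt, hlam] using hs)
  simpa using h

/-- Parseval: the coefficients of `u` along the orthonormal tensors are `√λ`, and pairing the series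
with `u` sums their squares. -/
theorem hasSum_lam_of_hasSum_tensorLp {ι : Type*} {lam : ι → ℝ} {Y : ι → Lp ℝ 2 μ} {φ : ι → H}
    (hlam : ∀ i, 0 ≤ lam i) (hY : Orthonormal ℝ Y) (hφ : Orthonormal ℝ φ) {u : Lp H 2 μ}
    (hu : HasSum (fun i => Real.sqrt (lam i) • tensorLp (Y i) (φ i)) u) :
    HasSum lam (‖u‖ ^ 2) := by
  classical
  have hE := orthonormal_iff_ite.1 (hY.tensorLp hφ)
  have hcoef : ∀ i, inner ℝ (tensorLp (Y i) (φ i)) u = Real.sqrt (lam i) := by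
    intro i
    have h := hu.mapL (innerSL ℝ (tensorLp (Y i) (φ i)))
    simp only [innerSL_apply_apply, inner_smul_right, hE, mul_ite, mul_one, mul_zero] at h
    refine h.unique ?_
    have h' := hasSum_single (f := fun j => if i = j then Real.sqrt (lam j) else 0) i
      fun j hj => if_neg (Ne.symm hj)
    simpa using h'
  have h := hu.mapL (innerSL ℝ u)
  rw [innerSL_apply_apply, real_inner_self_eq_norm_sq] at h
  refine (congrArg (HasSum · (‖u‖ ^ 2)) (funext fun i => ?_)).mp h
  rw [innerSL_apply_apply, inner_smul_right, real_inner_comm, hcoef, Real.mul_self_sqrt (hlam i)]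

theorem integral_eq_zero_of_hasSum_tensorLp [IsProbabilityMeasure μ] [CompleteSpace H]
    {ι : Type*} {lam : ι → ℝ} {Y : ι → Lp ℝ 2 μ} {φ : ι → H}
    (hY : ∀ i, ∫ ω, Y i ω ∂μ = 0) {u : Lp H 2 μ}
    (hu : HasSum (fun i => Real.sqrt (lam i) • tensorLp (Y i) (φ i)) u) :
    ∫ ω, u ω ∂μ = 0 := by
  -- Pairing with a constant function `x` is continuous on `L²` and computes `⟪x, E(u)⟫`.
  have h0 : ∀ x, inner ℝ (Lp.const 2 μ x) u = (0 : ℝ) := by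
    intro x
    have h := hu.mapL (innerSL ℝ (Lp.const 2 μ x))
    have hz : ∀ i, innerSL ℝ (Lp.const 2 μ x) (Real.sqrt (lam i) • tensorLp (Y i) (φ i)) = 0 := by
      intro i
      rw [innerSL_apply_apply, inner_smul_right, L2.inner_def]
      have : ∫ ω, inner ℝ (Lp.const 2 μ x ω) (tensorLp (Y i) (φ i) ω) ∂μ
          = ∫ ω, Y i ω * inner ℝ x (φ i) ∂μ := by
        refine integral_congr_ae ?_
        filter_upwards [Lp.coeFn_const (p := 2) (μ := μ) x, coeFn_tensorLp (Y i) (φ i)]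
          with ω h1 h2
        rw [h1, h2, inner_smul_right, Function.const_apply]
      rw [this, integral_mul_const, hY, zero_mul, mul_zero]
    simp only [hz] at h
    exact h.unique hasSum_zero
  refine integral_eq_zero_of_forall_integral_inner_eq_zero ℝ _
    ((Lp.memLp u).integrable one_le_two) fun x => ?_
  rw [← h0 x, L2.inner_def]
  refine integral_congr_ae ?_
  filter_upwards [Lp.coeFn_const (p := 2) (μ := μ) x] with ω h1
  rw [h1, Function.const_apply]

open Classical in
theorem klePartialSum_ae_eq {R : ℕ∞} (lam : KLEIndex R → ℝ) (Y : KLEIndex R → Lp ℝ 2 μ)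
    (φ : KLEIndex R → H) (n : ℕ) :
    klePartialSum lam Y φ n =ᵐ[μ] (∑ k ∈ Finset.range n, if h : (k : ℕ∞) < R then
      Real.sqrt (lam ⟨k, h⟩) • tensorLp (Y ⟨k, h⟩) (φ ⟨k, h⟩) else 0 : Lp H 2 μ) := by
  induction n with
  | zero =>
    filter_upwards [Lp.coeFn_zero H 2 μ] with ω h
    exact h.symm
  | succ n ih =>
    rw [Finset.sum_range_succ]
    have hstep : (fun ω => if h : (n : ℕ∞) < R then
        (Real.sqrt (lam ⟨n, h⟩) * Y ⟨n, h⟩ ω) • φ ⟨n, h⟩ else 0) =ᵐ[μ]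
        (if h : (n : ℕ∞) < R then
          Real.sqrt (lam ⟨n, h⟩) • tensorLp (Y ⟨n, h⟩) (φ ⟨n, h⟩) else 0 : Lp H 2 μ) := by
      by_cases h : (n : ℕ∞) < R
      · simp only [h, dif_pos]
        filter_upwards [Lp.coeFn_smul (Real.sqrt (lam ⟨n, h⟩)) (tensorLp (Y ⟨n, h⟩) (φ ⟨n, h⟩)),
          coeFn_tensorLp (Y ⟨n, h⟩) (φ ⟨n, h⟩)] with ω h1 h2
        rw [h1, Pi.smul_apply, h2, smul_smul]
      · simp only [h, dif_neg, not_false_eq_true]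
        exact (Lp.coeFn_zero H 2 μ).symm
    refine .trans ?_ (Lp.coeFn_add _ _).symm
    filter_upwards [ih, hstep] with ω h1 h2
    rw [Pi.add_apply, ← h1, ← h2, klePartialSum, Finset.sum_range_succ, klePartialSum]

theorem IsKLESystem.isKLE_of_hasSum [IsProbabilityMeasure μ] [CompleteSpace H] {R : ℕ∞}
    {lam : KLEIndex R → ℝ} {Y : KLEIndex R → Lp ℝ 2 μ} {φ : KLEIndex R → H}
    (hsys : IsKLESystem μ R lam Y φ) {u : Lp H 2 μ}
    (hu : HasSum (fun r => Real.sqrt (lam r) • tensorLp (Y r) (φ r)) u) (m : H) {v : Ω → H}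
    (hv : v =ᵐ[μ] fun ω => m + u ω) :
    MemLp v 2 μ ∧ ∫ ω, v ω ∂μ = m ∧ IsKLE μ v R lam Y φ := by
  classical
  have hmem : MemLp v 2 μ := MemLp.ae_eq hv.symm ((memLp_const m).add (Lp.memLp u))
  have hint : ∫ ω, v ω ∂μ = m := by
    rw [integral_congr_ae hv, integral_add (integrable_const m)
      ((Lp.memLp u).integrable one_le_two), integral_eq_zero_of_hasSum_tensorLp hsys.Y_mean_zero hu]
    simp
  refine ⟨hmem, hint, hsys, hmem.integrable one_le_two, ?_, ?_⟩
  · rw [hint]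
    -- Extension by zero to all of `ℕ` treats finite and infinite `R` alike and gives convergence
    -- along `Finset.range`.
    set g : ℕ → Lp H 2 μ := fun k => if h : (k : ℕ∞) < R then
      Real.sqrt (lam ⟨k, h⟩) • tensorLp (Y ⟨k, h⟩) (φ ⟨k, h⟩) else 0 with hg
    have hsum : HasSum g u := by
      refine (Function.Injective.hasSum_iff (f := g) (a := u)
        (Subtype.val_injective (p := fun r : ℕ => (r : ℕ∞) < R)) ?_).1 ?_
      · intro k hk
        have : ¬ (k : ℕ∞) < R := fun h => hk ⟨⟨k, h⟩, rfl⟩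
        simp [hg, this]
      · convert hu using 2 with r
        simp [hg, r.2]
    have ht : Tendsto (fun n => ‖u - ∑ k ∈ Finset.range n, g k‖ₑ) atTop (𝓝 0) := by
      have hc : Continuous fun w : Lp H 2 μ => ‖u - w‖ₑ := by fun_prop
      have := (hc.tendsto u).comp hsum.tendsto_sum_nat
      simpa [Function.comp_def] using this
    refine ht.congr fun n => ?_
    rw [Lp.enorm_def]
    refine eLpNorm_congr_ae ?_
    filter_upwards [hv, klePartialSum_ae_eq lam Y φ n,
      Lp.coeFn_sub u (∑ k ∈ Finset.range n, g k)] with ω h1 h2 h3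
    rw [h1, h2, h3, Pi.sub_apply, add_sub_cancel_left]
  · have h := hasSum_lam_of_hasSum_tensorLp (fun r => (hsys.lam_pos r).le) hsys.Y_orthonormal
      hsys.φ_orthonormal hu
    have hnorm : eLpNorm (fun ω => v ω - ∫ x, v x ∂μ) 2 μ = ‖u‖ₑ := by
      rw [Lp.enorm_def, hint]
      refine eLpNorm_congr_ae ?_
      filter_upwards [hv] with ω h1
      rw [h1, add_sub_cancel_left]
    rw [hnorm, ← ENNReal.ofReal_tsum_of_nonneg (fun r => (hsys.lam_pos r).le) h.summable,
      h.tsum_eq, ENNReal.ofReal_pow (norm_nonneg _), ofReal_norm]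

theorem IsKLE.memLp [IsFiniteMeasure μ] {R : ℕ∞} {lam : KLEIndex R → ℝ}
    {Y : KLEIndex R → Lp ℝ 2 μ} {φ : KLEIndex R → H} {v : Ω → H} (h : IsKLE μ v R lam Y φ) :
    MemLp v 2 μ := by
  classical
  have hS : ∀ n, MemLp (klePartialSum lam Y φ n : Ω → H) 2 μ := fun n =>
    MemLp.ae_eq (klePartialSum_ae_eq lam Y φ n).symm (Lp.memLp _)
  -- One remainder of finite norm suffices.
  obtain ⟨n, hn⟩ := (h.tendsto_sum.eventually_lt_const ENNReal.zero_lt_top).exists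
  have hdiff : MemLp (fun ω => v ω - (∫ x, v x ∂μ) - klePartialSum lam Y φ n ω) 2 μ :=
    ⟨(h.integrable.aestronglyMeasurable.sub aestronglyMeasurable_const).sub
      (hS n).aestronglyMeasurable, hn⟩
  refine MemLp.ae_eq (.of_forall fun ω => ?_) ((hdiff.add (hS n)).add
    (memLp_const (∫ x, v x ∂μ)))
  simp

end System

/-! ### Spectral theorem and singular value decomposition. -/

section Existence

/-- Spectral theorem: a compact symmetric operator has an orthonormal family of eigenvectors
which spans a dense subspace. -/
theorem exists_orthonormal_eigenvectors.{u} {H : Type u} [NormedAddCommGroup H]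
    [InnerProductSpace ℝ H] [CompleteSpace H] {T : H →L[ℝ] H} (hT : IsCompactOperator T)
    (hT' : (T : H →ₗ[ℝ] H).IsSymmetric) :
    ∃ (ι : Type u) (b : ι → H) (lam : ι → ℝ), Orthonormal ℝ b ∧ (∀ i, T (b i) = lam i • b i) ∧
      (Submodule.span ℝ (Set.range b)).topologicalClosure = ⊤ := by
  have hcl : ∀ ν : ℝ, CompleteSpace (Module.End.eigenspace (T : Module.End ℝ H) ν) := by
    intro ν
    refine IsClosed.completeSpace_coe (hs := ?_)
    have : (Module.End.eigenspace (T : Module.End ℝ H) ν : Set H) = {x | T x = ν • x} := by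
      ext x
      exact Module.End.mem_eigenspace_iff
    rw [this]
    exact isClosed_eq T.continuous (by fun_prop)
  choose w hw using fun ν : ℝ =>
    exists_hilbertBasis ℝ (Module.End.eigenspace (T : Module.End ℝ H) ν)
  choose B hB using hw
  have hon := hT'.orthogonalFamily_eigenspaces.orthonormal_sigma_orthonormal
    (fun ν => (B ν).orthonormal)
  refine ⟨Σ ν, w ν, fun a => (B a.1 a.2 : H), fun a => a.1, hon, ?_, ?_⟩
  · intro a
    exact Module.End.mem_eigenspace_iff.1 (B a.1 a.2).2
  · set K := Submodule.span ℝ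
      (Set.range fun a : Σ ν, w ν => (B a.1 a.2 : H)) with hK
    -- All eigenspaces together, the kernel included, have trivial orthogonal complement; it remains
    -- to place each in the closure of `K`.
    rw [Submodule.topologicalClosure_eq_top_iff, eq_bot_iff,
      ← ContinuousLinearMap.orthogonalComplement_iSup_eigenspaces_eq_bot hT hT',
      ← Submodule.orthogonal_closure K]
    refine Submodule.orthogonal_le ?_
    refine iSup_le fun ν x hx => ?_
    have hsum := (B ν).hasSum_repr ⟨x, hx⟩
    have hsum' := hsum.mapL (Module.End.eigenspace (T : Module.End ℝ H) ν).subtypeL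
    refine mem_closure_of_tendsto hsum' (.of_forall fun s => ?_)
    refine Submodule.sum_mem _ fun i _ => ?_
    rw [map_smul]
    exact Submodule.smul_mem _ _ (Submodule.subset_span ⟨⟨ν, i⟩, rfl⟩)

/-- Singular value decomposition of `x ↦ ⟪x, u⟫`, with the singular vectors not yet ordered. -/
theorem exists_hasSum_sqrt_smul_tensorLp.{u} {Ω : Type*} [MeasurableSpace Ω] {μ : Measure Ω}
    [IsProbabilityMeasure μ] {H : Type u} [NormedAddCommGroup H] [InnerProductSpace ℝ H]
    [CompleteSpace H] (u : Lp H 2 μ)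
    (hmean : ∫ ω, u ω ∂μ = 0) :
    ∃ (ι : Type u) (lam : ι → ℝ) (Y : ι → Lp ℝ 2 μ) (φ : ι → H),
      (∀ i, 0 < lam i) ∧ Orthonormal ℝ Y ∧ (∀ i, ∫ ω, Y i ω ∂μ = 0) ∧ Orthonormal ℝ φ ∧
      HasSum (fun i => Real.sqrt (lam i) • tensorLp (Y i) (φ i)) u := by
  classical
  set A := coordLp μ H u with hA
  let T : H →L[ℝ] H := (ContinuousLinearMap.adjoint A).comp A
  have hT : IsCompactOperator T :=
    (isCompactOperator_coordLp u).clm_comp (ContinuousLinearMap.adjoint A)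
  have hTA : ∀ x y, inner ℝ (T x) y = inner ℝ (A x) (A y) := fun x y =>
    ContinuousLinearMap.adjoint_inner_left A y (A x)
  have hT' : (T : H →ₗ[ℝ] H).IsSymmetric := by
    intro x y
    change inner ℝ (T x) y = inner ℝ x (T y)
    rw [real_inner_comm (T y) x, hTA, hTA, real_inner_comm]
  obtain ⟨κ, b, nu, hb, hTb, hspan⟩ := exists_orthonormal_eigenvectors hT hT'
  have hAb : ∀ i j, inner ℝ (A (b i)) (A (b j)) = if i = j then nu i else 0 := by
    intro i j
    rw [← hTA, hTb, real_inner_smul_left, orthonormal_iff_ite.1 hb]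
    simp
  have hnu : ∀ i, ‖A (b i)‖ ^ 2 = nu i := by
    intro i
    rw [← real_inner_self_eq_norm_sq, hAb, if_pos rfl]
  have hker : ∀ i, ¬ 0 < nu i → A (b i) = 0 := by
    intro i hi
    have : ‖A (b i)‖ ^ 2 = 0 := le_antisymm (hnu i ▸ not_lt.1 hi) (sq_nonneg _)
    simpa using this
  let ι := {i : κ // 0 < nu i}
  let Y : ι → Lp ℝ 2 μ := fun i => (Real.sqrt (nu i))⁻¹ • A (b i)
  have hsq : ∀ i : ι, Real.sqrt (nu i) ≠ 0 := fun i => (Real.sqrt_pos.2 i.2).ne'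
  have hY : ∀ i : ι, Real.sqrt (nu i) • Y i = A (b i) := fun i => smul_inv_smul₀ (hsq i) _
  have hYon : Orthonormal ℝ Y := by
    rw [orthonormal_iff_ite]
    intro i j
    rw [real_inner_smul_left, inner_smul_right, hAb]
    by_cases hij : i = j
    · subst hij
      rw [if_pos rfl, if_pos rfl]
      nth_rewrite 3 [← Real.mul_self_sqrt i.2.le]
      field_simp [hsq i]
    · rw [if_neg hij, if_neg fun h => hij (Subtype.ext h)]
      simp
  have hφ : Orthonormal ℝ fun i : ι => b i := hb.comp _ Subtype.val_injective
  have hYmean : ∀ i, ∫ ω, Y i ω ∂μ = 0 := by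
    intro i
    rw [integral_congr_ae (Lp.coeFn_smul _ _)]
    simp only [Pi.smul_apply]
    rw [integral_smul, hA, integral_coordLp, hmean, inner_zero_right, smul_zero]
  -- Bessel's inequality: the coefficient of `u` along the `i`-th tensor is `√(nu i)`.
  have hsum : Summable fun i : ι => nu i := by
    have h := (hYon.tensorLp hφ).inner_products_summable u
    refine h.congr fun i => ?_
    rw [inner_tensorLp_left, ← hA, ← hY i, inner_smul_right, real_inner_self_eq_norm_sq,
      hYon.1 i, one_pow, mul_one, Real.norm_eq_abs, sq_abs, Real.sq_sqrt i.2.le]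
  obtain ⟨s, hs⟩ := summable_sqrt_smul_tensorLp (fun i : ι => i.2.le) hYon hφ hsum
  -- This covers every eigenvector: where `nu k` is not positive, both sides vanish.
  have hcoord : ∀ k, coordLp μ H s (b k) = A (b k) := by
    intro k
    have h := hs.mapL ((ContinuousLinearMap.apply ℝ (Lp ℝ 2 μ) (b k)).comp (coordLp μ H))
    have hterm : ∀ i : ι, ((ContinuousLinearMap.apply ℝ (Lp ℝ 2 μ) (b k)).comp (coordLp μ H))
        (Real.sqrt (nu i) • tensorLp (Y i) (b i)) = if k = i then A (b i) else 0 := by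
      intro i
      rw [map_smul, ContinuousLinearMap.comp_apply, ContinuousLinearMap.apply_apply,
        coordLp_tensorLp, orthonormal_iff_ite.1 hb, smul_comm, hY]
      simp
    simp only [hterm] at h
    refine h.unique ?_
    by_cases hk : 0 < nu k
    · have := hasSum_single (f := fun i : ι => if k = i then A (b i) else 0) ⟨k, hk⟩
        fun i hi => if_neg fun h => hi (Subtype.ext h.symm)
      simpa using this
    · rw [hker k hk]
      have hz : (fun i : ι => if k = i then A (b i) else 0) = fun _ => 0 :=
        funext fun i => if_neg fun hi : k = i.1 => hk (hi.symm ▸ i.2)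
      rw [hz]
      exact hasSum_zero
  have hzero : coordLp μ H (u - s) = 0 := by
    rw [map_sub, sub_eq_zero]
    refine ContinuousLinearMap.ext_on
      ((Submodule.dense_iff_topologicalClosure_eq_top).2 hspan) ?_
    rintro _ ⟨k, rfl⟩
    exact (hcoord k).symm
  have hus : u = s := sub_eq_zero.1 (eq_zero_of_coordLp_eq_zero hzero)
  exact ⟨ι, fun i => nu i, Y, fun i => b i, fun i => i.2, hYon, hYmean, hφ, hus ▸ hs⟩

theorem MeasureTheory.MemLp.admitsKLE {Ω : Type*} [MeasurableSpace Ω] {μ : Measure Ω}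
    [IsProbabilityMeasure μ] {H : Type*} [NormedAddCommGroup H] [InnerProductSpace ℝ H]
    [CompleteSpace H] {v : Ω → H} (hv : MemLp v 2 μ) :
    AdmitsKLE μ v := by
  set m := ∫ ω, v ω ∂μ with hm
  have hw : MemLp (fun ω => v ω - m) 2 μ := hv.sub (memLp_const m)
  have hvu : v =ᵐ[μ] fun ω => m + hw.toLp _ ω := by
    filter_upwards [hw.coeFn_toLp] with ω h
    rw [h, add_sub_cancel]
  have hmean : ∫ ω, hw.toLp _ ω ∂μ = 0 := by
    rw [integral_congr_ae hw.coeFn_toLp,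
      integral_sub (hv.integrable one_le_two) (integrable_const m)]
    simp [hm]
  obtain ⟨ι, lam, Y, φ, hpos, hY, hYmean, hφ, hsum⟩ :=
    exists_hasSum_sqrt_smul_tensorLp (hw.toLp _) hmean
  obtain ⟨R, e, he⟩ := exists_enat_equiv_antitone_of_summable hpos
    (hasSum_lam_of_hasSum_tensorLp (fun i => (hpos i).le) hY hφ hsum).summable
  have hsys : IsKLESystem μ R (lam ∘ e) (Y ∘ e) (φ ∘ e) :=
    { lam_pos := fun r => hpos (e r)
      lam_antitone := he
      Y_orthonormal := hY.comp e e.injective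
      Y_mean_zero := fun r => hYmean (e r)
      φ_orthonormal := hφ.comp e e.injective }
  exact ⟨R, lam ∘ e, Y ∘ e, φ ∘ e, (hsys.isKLE_of_hasSum (e.hasSum_iff.2 hsum) m hvu).2.2⟩

end Existence

theorem mainTheorem1 {Ω : Type*} [MeasurableSpace Ω] (μ : Measure Ω) [IsProbabilityMeasure μ]
    {H : Type*} [NormedAddCommGroup H] [InnerProductSpace ℝ H] [CompleteSpace H] :
    (∀ v : Ω → H, MemLp v 2 μ → AdmitsKLE μ v) ∧
    (∀ v : Ω → H, AdmitsKLE μ v → MemLp v 2 μ) ∧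
    (∀ (R : ℕ∞) (lam : KLEIndex R → ℝ) (Y : KLEIndex R → Lp ℝ 2 μ) (φ : KLEIndex R → H),
      IsKLESystem μ R lam Y φ → Summable lam →
        ∀ m : H, ∃ v : Ω → H, MemLp v 2 μ ∧ ∫ ω, v ω ∂μ = m ∧ IsKLE μ v R lam Y φ) := by
  refine ⟨fun v hv => hv.admitsKLE, fun v hv => ?_, fun R lam Y φ hsys hsum m => ?_⟩
  · obtain ⟨R, lam, Y, φ, h⟩ := hv
    exact h.memLp
  · obtain ⟨u, hu⟩ := summable_sqrt_smul_tensorLp (fun r => (hsys.lam_pos r).le)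
      hsys.Y_orthonormal hsys.φ_orthonormal hsum
    exact ⟨fun ω => m + u ω, hsys.isKLE_of_hasSum hu m .rfl⟩
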